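/- Let $k\in\mathbb N$. A $k$-marked group $\mathbf G=(G;s_1,\dots,s_k)$ is a group $G$ together with an ordered $k$-tuple of generators. A sequence $\mathbf G_m=(G_m;s^{(m)}_1,\dots,s^{(m)}_k)$ converges to $\mathbf G$ in the Cayley topology if the indicator functions of the kernels of the marked quotient maps $F_k\to G_m$ converge pointwise on the free group $F_k$ to that of the kernel of $F_k\to G$. The Cayley graph $\mathrm{Cay}(\mathbf G)$ has vertex set $G$ and an edge between $g$ and $s_jg$ for all $g\in G$ and all $j$; it carries the path metric. A group $H$ has property $(\mathrm F_{\mathcal E})$, for a class $\mathcal E$ of Banach spaces, if for every $E\in\mathcal E$ every action of $H$ on $E$ by isometries has a global fixed point. For a non-principal ultrafilter $\mathcal U$ on $\mathbb N$ and Banach spaces $E_m$, $\lim_{\mathcal U}(E_m,0)$ denotes the space of bounded sequences $(x_m)_m$ with $x_m\in E_m$, with the seminorm $\lim_{\mathcal U}\|x_m\|$, modulo the sequences of seminorm $0$. For $q\in[1,\infty)$, a sequence $(\Gamma_m)_{m\in\mathbb N}$ of finite connected graphs of uniformly bounded degree admits embedded Banach $(\mathcal E,q)$-expanders if there are a subsequence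 $(m_n)_n$ and finite connected graphs $(\Lambda_n)_n$ such that: (a) there is $D>0$ such that for every $n$ there is an injective map $\iota_n\colon V(\Lambda_n)\to V(\Gamma_{m_n})$ that is $D$-Lipschitz for the path metrics; (b) there is $d\ge 2$ such that for every $n$ all vertices of $\Lambda_n$ have degree at most $d$; (c) $\sharp V(\Lambda_n)\to\infty$; (d) for every $E\in\mathcal E$ there is $C_E>0$ such that for every $n$ and every $f\colon V(\Lambda_n)\to E$, \[ \frac1{\sharp V(\Lambda_n)}\sum_{v\in V(\Lambda_n)}\|f(v)-m(f)\|^q\le C_E\,\frac1{\sharp V(\Lambda_n)}\sum_{\{v,w\}\in E(\Lambda_n)}\|f(v)-f(w)\|^q,\qquad m(f)=\frac1{\sharp V(\Lambda_n)}\sum_{v\in V(\Lambda_n)}f(v). \] **Proposition.** Let $(\mathbf G_m)_{m\in\mathbb N}$ be a sequence of finite $k$-marked groups that converges in the Cayley topology to a $k$-marked group $\mathbf G=(G;s_1,\dots,s_k)$. Let $\mathcal E$ be a non-empty class of (real or complex) Banach spaces and $q\in[1,\infty)$, such that, membership being understood up to isometric linear isomorphism, (1) $\ell_q(\mathbb N,E)\in\mathcal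 E$ for every $E\in\mathcal E$; (2) $\mathcal E=\bigcup_\lambda\mathcal E_\lambda$ for subclasses $\mathcal E_\lambda$ each of which has the following property: for every sequence $(E_m)_{m\in\mathbb N}$ in $\mathcal E_\lambda$ there is a non-principal ultrafilter $\mathcal U$ on $\mathbb N$ with $\lim_{\mathcal U}(E_m,0)\in\mathcal E_\lambda$. Assume that $G$ contains an infinite subgroup $H$ with property $(\mathrm F_{\mathcal E})$. Then the sequence of Cayley graphs $(\mathrm{Cay}(\mathbf G_m))_{m\in\mathbb N}$ admits embedded Banach $(\mathcal E,q)$-expanders. -/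

import Mathlib

open Filter Topology
open scoped ENNReal

universe u v

noncomputable section

/-! ### Marked groups, the Cayley topology, Cayley graphs -/

/-- A `k`-marked group: a group with an ordered `k`-tuple of generators. -/
structure MarkedGroup (k : ℕ) where
  carrier : Type v
  [group : Group carrier]
  gen : Fin k → carrier
  closure_gen : Subgroup.closure (Set.range gen) = ⊤

attribute [instance] MarkedGroup.group

namespace MarkedGroup

variable {k : ℕ}

/-- The kernel of the standard marked quotient map from the free group on `k` letters. -/
def ker (G : MarkedGroup.{v} k) : Subgroup (FreeGroup (Fin k)) :=
  (FreeGroup.lift G.gen).ker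

open Classical in
/-- The indicator function, in `{0,1}^{F_k}`, of the normal subgroup of `F_k` that corresponds
to the marked group. -/
def code (G : MarkedGroup.{v} k) : FreeGroup (Fin k) → Bool :=
  fun w => decide (w ∈ G.ker)

/-- The Cayley topology: the topology induced by the product topology on `{0,1}^{F_k}`.
(Marked groups are not identified here when they are isomorphic as marked groups; isomorphic ones
are topologically indistinguishable, so that the convergence is the same.) -/
instance : TopologicalSpace (MarkedGroup.{v} k) :=
  TopologicalSpace.induced code inferInstance

/-- The Cayley graph, with an edge between `g` and `s_j g` for all `g` and `j`. -/
def cayleyGraph (G : MarkedGroup.{v} k) : SimpleGraph G.carrier :=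
  SimpleGraph.fromRel fun g h => ∃ j, h = G.gen j * g

end MarkedGroup

/-! ### Classes of Banach spaces, the fixed point property -/

/-- Banach spaces over `𝕜`; a class of Banach spaces is a `Set (BanachSp 𝕜)`. -/
structure BanachSp (𝕜 : Type*) [RCLike 𝕜] where
  carrier : Type u
  [normed : NormedAddCommGroup carrier]
  [normedSpace : NormedSpace 𝕜 carrier]
  [complete : CompleteSpace carrier]

attribute [instance] BanachSp.normed BanachSp.normedSpace BanachSp.complete

/-- Property `(F_𝓔)`: every action of `H` by (surjective) isometries on a space of the class `𝓔`
has a global fixed point. -/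
def PropertyF {𝕜 : Type*} [RCLike 𝕜] (𝓔 : Set (BanachSp.{u} 𝕜)) (H : Type*) [Group H] : Prop :=
  ∀ E ∈ 𝓔, ∀ α : H →* (E.carrier ≃ᵢ E.carrier), ∃ x : E.carrier, ∀ h : H, α h x = x

/-- The class contains, up to isometric linear isomorphism, the normed space `X`. -/
def ContainsSpace {𝕜 : Type*} [RCLike 𝕜] (𝓔 : Set (BanachSp.{u} 𝕜))
    (X : Type*) [NormedAddCommGroup X] [NormedSpace 𝕜 X] : Prop :=
  ∃ F ∈ 𝓔, Nonempty (F.carrier ≃ₗᵢ[𝕜] X)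

/-! ### Ultraproducts of Banach spaces, with base points `0` -/

section Ultraproduct

variable {E : ℕ → Type u} [∀ m, NormedAddCommGroup (E m)]

/-- The bounded sequences `(x_m)` with `x_m ∈ E m`; to be equipped with the seminorm
`lim_𝓤 ‖x_m‖`. -/
def UltraBounded (_𝓤 : Ultrafilter ℕ) (E : ℕ → Type u) [∀ m, NormedAddCommGroup (E m)] :
    Type u :=
  lp E ∞

namespace UltraBounded

variable {𝓤 : Ultrafilter ℕ}

instance : AddCommGroup (UltraBounded 𝓤 E) := inferInstanceAs (AddCommGroup (lp E ∞))

instance {𝕜 : Type*} [RCLike 𝕜] [∀ m, NormedSpace 𝕜 (E m)] : Module 𝕜 (UltraBounded 𝓤 E) :=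
  inferInstanceAs (Module 𝕜 (lp E ∞))

/-- A bounded sequence as an element of the `ℓ_∞`-product. -/
def toLp (x : UltraBounded 𝓤 E) : lp E ∞ := x

/-- The `m`-th term of a bounded sequence. -/
def coord (x : UltraBounded 𝓤 E) (m : ℕ) : E m := x.toLp m

variable (𝓤) in
/-- The limit of the norms along the ultrafilter. -/
def ultraNorm (x : UltraBounded 𝓤 E) : ℝ := limUnder (𝓤 : Filter ℕ) fun m => ‖x.coord m‖

theorem tendsto_ultraNorm (x : UltraBounded 𝓤 E) :
    Tendsto (fun m => ‖x.coord m‖) (𝓤 : Filter ℕ) (𝓝 (ultraNorm 𝓤 x)) := by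
  have hb : ∀ m, ‖x.coord m‖ ∈ Set.Icc (0 : ℝ) ‖x.toLp‖ := fun m =>
    ⟨norm_nonneg _, lp.norm_apply_le_norm ENNReal.top_ne_zero x.toLp m⟩
  have hc : IsCompact (Set.Icc (0 : ℝ) ‖x.toLp‖) := isCompact_Icc
  obtain ⟨a, -, ha⟩ := hc.ultrafilter_le_nhds (𝓤.map fun m => ‖x.coord m‖)
    (le_principal_iff.2 (Filter.Eventually.of_forall (f := (𝓤 : Filter ℕ)) hb))
  exact tendsto_nhds_limUnder ⟨a, ha⟩

instance : SeminormedAddCommGroup (UltraBounded 𝓤 E) :=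
  AddGroupSeminorm.toSeminormedAddCommGroup
    { toFun := ultraNorm 𝓤
      map_zero' := by
        refine tendsto_nhds_unique (tendsto_ultraNorm (𝓤 := 𝓤) (0 : UltraBounded 𝓤 E)) ?_
        refine tendsto_const_nhds.congr fun m => ?_
        exact (norm_zero (E := E m)).symm
      add_le' := fun x y =>
        le_of_tendsto_of_tendsto' (tendsto_ultraNorm (x + y))
          ((tendsto_ultraNorm x).add (tendsto_ultraNorm y)) fun m =>
            norm_add_le (x.coord m) (y.coord m)
      neg' := fun x => by
        refine tendsto_nhds_unique (tendsto_ultraNorm (-x)) ?_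
        exact (tendsto_ultraNorm x).congr fun m => (norm_neg (x.coord m)).symm }

theorem tendsto_norm (x : UltraBounded 𝓤 E) :
    Tendsto (fun m => ‖x.coord m‖) (𝓤 : Filter ℕ) (𝓝 ‖x‖) :=
  tendsto_ultraNorm x

instance {𝕜 : Type*} [RCLike 𝕜] [∀ m, NormedSpace 𝕜 (E m)] :
    NormedSpace 𝕜 (UltraBounded 𝓤 E) where
  norm_smul_le c x := by
    refine le_of_eq (tendsto_nhds_unique (tendsto_norm (c • x)) ?_)
    exact ((tendsto_norm x).const_mul ‖c‖).congr fun m => (norm_smul c (x.coord m)).symm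

end UltraBounded

/-- The ultraproduct `lim_𝓤 (E_m, 0)`: bounded sequences modulo those at distance `0`, where the
distance of `(x_m)` and `(y_m)` is `lim_𝓤 ‖x_m - y_m‖`. -/
abbrev BanachUltraproduct (𝓤 : Ultrafilter ℕ) (E : ℕ → Type u)
    [∀ m, NormedAddCommGroup (E m)] : Type u :=
  SeparationQuotient (UltraBounded 𝓤 E)

end Ultraproduct

/-- For every sequence in the class there is a non-principal ultrafilter (one that contains all
cofinite sets) along which the ultraproduct of the sequence is in the class. -/
def ClosedUnderSomeUltraproduct {𝕜 : Type*} [RCLike 𝕜] (𝓢 : Set (BanachSp.{u} 𝕜)) : Prop :=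
  ∀ E : ℕ → BanachSp.{u} 𝕜, (∀ m, E m ∈ 𝓢) →
    ∃ 𝓤 : Ultrafilter ℕ, (𝓤 : Filter ℕ) ≤ cofinite ∧
      ContainsSpace 𝓢 (BanachUltraproduct 𝓤 fun m => (E m).carrier)

/-! ### Embedded Banach expanders -/

/-- A sequence of finite connected graphs whose degrees are bounded by a common `d ≥ 2`. -/
def IsBoundedDegreeFamily {V : ℕ → Type*} (Γ : ∀ n, SimpleGraph (V n)) : Prop :=
  (∀ n, Finite (V n)) ∧ (∀ n, (Γ n).Connected) ∧
    ∃ d : ℕ, 2 ≤ d ∧ ∀ n, ∀ v : V n, ((Γ n).neighborSet v).ncard ≤ d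

/-- The quantity `‖f v - f w‖ ^ q` of an unordered pair `{v, w}`. -/
def edgeEnergy {W E : Type*} [NormedAddCommGroup E] (q : ℝ) (f : W → E) (e : Sym2 W) : ℝ :=
  Sym2.lift ⟨fun v w => ‖f v - f w‖ ^ q, fun v w =>
    congrArg (· ^ q) (norm_sub_rev (f v) (f w))⟩ e

open Classical in
/-- The Poincaré-type inequality with exponent `q` and constant `C` for the maps from the vertex
set of the finite graph `Λ` to the Banach space `E`. -/
def PoincareInequality {𝕜 : Type*} [RCLike 𝕜] {W : Type*} [Fintype W] (Λ : SimpleGraph W)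
    (E : BanachSp.{u} 𝕜) (q C : ℝ) : Prop :=
  ∀ f : W → E.carrier,
    (1 / (Fintype.card W : ℝ)) *
        ∑ v, ‖f v - (Fintype.card W : 𝕜)⁻¹ • ∑ w, f w‖ ^ q ≤
      C * ((1 / (Fintype.card W : ℝ)) * ∑ e ∈ Λ.edgeFinset, edgeEnergy q f e)

/-- The sequence of graphs `Γ` (finite, connected, of uniformly bounded degree) admits embedded
Banach `(𝓔, q)`-expanders. -/
def AdmitsEmbeddedBanachExpanders {𝕜 : Type*} [RCLike 𝕜] (𝓔 : Set (BanachSp.{u} 𝕜)) (q : ℝ)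
    {V : ℕ → Type v} (Γ : ∀ m, SimpleGraph (V m)) : Prop :=
  IsBoundedDegreeFamily Γ ∧
  ∃ φ : ℕ → ℕ, StrictMono φ ∧
  ∃ (W : ℕ → Type v) (_ : ∀ n, Fintype (W n)) (Λ : ∀ n, SimpleGraph (W n)),
    IsBoundedDegreeFamily Λ ∧
    (∃ D : ℝ, 0 < D ∧ ∀ n, ∃ ι : W n → V (φ n), Function.Injective ι ∧
      ∀ v w, ((Γ (φ n)).dist (ι v) (ι w) : ℝ) ≤ D * ((Λ n).dist v w : ℝ)) ∧
    Tendsto (fun n => Fintype.card (W n)) atTop atTop ∧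
    ∀ E ∈ 𝓔, ∃ C : ℝ, 0 < C ∧ ∀ n, PoincareInequality (Λ n) E q C

end

/-!
The embedded expanders are Cayley graphs of subgroups. The subgroup `H` may be taken to be finitely
generated: if the class `𝓔` contains a space `E ≠ 0`, then property `(F_𝓔)`, applied to an affine
action on an `ℓ_q`-space over cosets, forces finite generation (`fg_of_propertyF`), and if all
spaces in `𝓔` are zero, then the whole limit group can replace `H`
(`exists_ofWords_infinite_propertyF`). Words that generate `H` define subgroups `K_m ≤ G_m`, marked
by these words (`MarkedGroup.ofWords`), which converge to `H` in the Cayley topology. The inclusions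
`K_m → G_m` are uniformly Lipschitz for the word metrics, and the order of `K_m` tends to infinity
because `H` is infinite.

Each single finite connected graph has some Poincaré constant, so that a uniform one for the Cayley
graphs of the `K_m` fails to exist only if there are functions `f_n : K_{m_n} → E`, `m_n → ∞`, that
violate the inequality with constants tending to infinity. In the permutation representation of
`K_{m_n}` on `ℓ_q(ℕ × K_{m_n}, E)` such a function is a vector whose distance from the invariant
vectors is much larger than its displacement by the generators
(`exists_displacement_eq_one_of_not_poincareInequality`). By completeness some vector near it almost
minimizes the displacement on a large ball about it, relative to the displacement
(`exists_almost_minimal`); as the representation is linear, it can be rescaled to have displacement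
`1`.

All these `ℓ_q`-spaces are isometric to one space `F ∈ 𝓔`. On a suitable ultrapower of `F`, re-based
at the vectors found, the actions converge to an affine isometric action of the limit group `H`,
which has displacement at least `1 / 2` everywhere and hence no fixed point
(`exists_limit_action_without_fixedPoint`). This contradicts property `(F_𝓔)`.
-/

/-! ### Marked groups and their Cayley graphs -/

namespace MarkedGroup

variable {k : ℕ}

theorem lift_gen_surjective (G : MarkedGroup.{v} k) :
    Function.Surjective (FreeGroup.lift G.gen) := by
  rw [← MonoidHom.range_eq_top, FreeGroup.range_lift_eq_closure, G.closure_gen]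

instance (G : MarkedGroup.{v} k) : Countable G.carrier :=
  G.lift_gen_surjective.countable

/-- Convergence in the Cayley topology: each word is eventually a relation exactly when it is one
in the limit. -/
theorem eventually_lift_eq_one_iff {G : ℕ → MarkedGroup.{v} k} {G_lim : MarkedGroup.{v} k}
    (hlim : Tendsto G atTop (𝓝 G_lim)) (w : FreeGroup (Fin k)) :
    ∀ᶠ m in atTop, (FreeGroup.lift (G m).gen w = 1 ↔ FreeGroup.lift G_lim.gen w = 1) := by
  rw [nhds_induced, tendsto_comap_iff, tendsto_pi_nhds] at hlim
  have h := hlim w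
  rw [nhds_discrete, tendsto_pure] at h
  filter_upwards [h] with m hm
  exact decide_eq_decide.1 hm

/-- The subgroup generated by finitely many words in the generators, marked by these words. -/
def ofWords (G : MarkedGroup.{v} k) {r : ℕ} (w : Fin r → FreeGroup (Fin k)) :
    MarkedGroup.{v} r where
  carrier := Subgroup.closure (Set.range fun j => FreeGroup.lift G.gen (w j))
  gen j := ⟨FreeGroup.lift G.gen (w j), Subgroup.subset_closure ⟨j, rfl⟩⟩
  closure_gen := by
    refine (congrArg Subgroup.closure ?_).trans
      (Subgroup.closure_closure_coe_preimage
        (k := Set.range fun j => FreeGroup.lift G.gen (w j)))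
    ext x
    simp only [Set.mem_range, Set.mem_preimage, Subtype.ext_iff]

/-- The inclusion of the subgroup generated by some words. -/
def ofWordsVal (G : MarkedGroup.{v} k) {r : ℕ} (w : Fin r → FreeGroup (Fin k)) :
    (G.ofWords w).carrier →* G.carrier :=
  (Subgroup.closure (Set.range fun j => FreeGroup.lift G.gen (w j))).subtype

theorem ofWordsVal_injective (G : MarkedGroup.{v} k) {r : ℕ} (w : Fin r → FreeGroup (Fin k)) :
    Function.Injective (G.ofWordsVal w) :=
  Subtype.val_injective

theorem ofWordsVal_gen (G : MarkedGroup.{v} k) {r : ℕ} (w : Fin r → FreeGroup (Fin k))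
    (j : Fin r) : G.ofWordsVal w ((G.ofWords w).gen j) = FreeGroup.lift G.gen (w j) :=
  rfl

theorem ofWordsVal_lift (G : MarkedGroup.{v} k) {r : ℕ} (w : Fin r → FreeGroup (Fin k))
    (x : FreeGroup (Fin r)) :
    G.ofWordsVal w (FreeGroup.lift (G.ofWords w).gen x) =
      FreeGroup.lift G.gen (FreeGroup.lift w x) := by
  have h : (G.ofWordsVal w).comp (FreeGroup.lift (G.ofWords w).gen) =
      (FreeGroup.lift G.gen).comp (FreeGroup.lift w) := by
    ext j
    simp [ofWordsVal_gen]
  exact DFunLike.congr_fun h x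

theorem lift_ofWords_eq_one_iff (G : MarkedGroup.{v} k) {r : ℕ} (w : Fin r → FreeGroup (Fin k))
    (x : FreeGroup (Fin r)) :
    FreeGroup.lift (G.ofWords w).gen x = 1 ↔ FreeGroup.lift G.gen (FreeGroup.lift w x) = 1 := by
  rw [← ofWordsVal_lift, map_eq_one_iff _ (G.ofWordsVal_injective w)]

/-- Distinct elements of the limit stay distinct in the approximating groups, whose orders
therefore tend to infinity when the limit is infinite. -/
theorem tendsto_card_atTop {G : ℕ → MarkedGroup.{v} k} {G_lim : MarkedGroup.{v} k}
    [∀ m, Fintype (G m).carrier] [Infinite G_lim.carrier]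
    (hlim : ∀ w : FreeGroup (Fin k), ∀ᶠ m in atTop,
      (FreeGroup.lift (G m).gen w = 1 ↔ FreeGroup.lift G_lim.gen w = 1)) :
    Tendsto (fun m => Fintype.card (G m).carrier) atTop atTop := by
  refine tendsto_atTop.2 fun N => ?_
  obtain ⟨s, rfl⟩ := Infinite.exists_subset_card_eq G_lim.carrier N
  obtain ⟨σ, hσ⟩ := G_lim.lift_gen_surjective.hasRightInverse
  have h : ∀ᶠ m in atTop, ∀ x ∈ s, ∀ y ∈ s,
      (FreeGroup.lift (G m).gen ((σ x)⁻¹ * σ y) = 1 ↔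
        FreeGroup.lift G_lim.gen ((σ x)⁻¹ * σ y) = 1) :=
    (eventually_all_finset s).2 fun x _ => (eventually_all_finset s).2 fun y _ => hlim _
  filter_upwards [h] with m hm
  refine Finset.card_le_card_of_injOn (fun x => FreeGroup.lift (G m).gen (σ x))
    (fun _ _ => Finset.mem_univ _) fun x hx y hy hxy => ?_
  have := (hm x hx y hy).1 (by simpa [inv_mul_eq_one] using hxy)
  rwa [map_mul, map_inv, hσ, hσ, inv_mul_eq_one] at this

theorem cayleyGraph_adj (G : MarkedGroup.{v} k) {g h : G.carrier} :
    G.cayleyGraph.Adj g h ↔ g ≠ h ∧ ((∃ j, h = G.gen j * g) ∨ ∃ j, g = G.gen j * h) :=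
  SimpleGraph.fromRel_adj _ _ _

theorem cayleyGraph_reachable_gen_mul (G : MarkedGroup.{v} k) (j : Fin k) (g : G.carrier) :
    G.cayleyGraph.Reachable g (G.gen j * g) := by
  by_cases h : g = G.gen j * g
  · rw [← h]
  · exact SimpleGraph.Adj.reachable (G.cayleyGraph_adj.2 ⟨h, Or.inl ⟨j, rfl⟩⟩)

theorem cayleyGraph_connected (G : MarkedGroup.{v} k) : G.cayleyGraph.Connected := by
  have h : ∀ w : FreeGroup (Fin k), ∀ g,
      G.cayleyGraph.Reachable g (FreeGroup.lift G.gen w * g) := by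
    intro w
    induction w using FreeGroup.induction_on with
    | C1 => intro g; simp
    | of j => intro g; simpa using G.cayleyGraph_reachable_gen_mul j g
    | inv_of j h =>
      intro g
      simpa using (h ((G.gen j)⁻¹ * g)).symm
    | mul x y hx hy =>
      intro g
      rw [map_mul, mul_assoc]
      exact (hy g).trans (hx _)
  have : Nonempty G.carrier := ⟨1⟩
  refine ⟨fun a b => ?_⟩
  obtain ⟨w, hw⟩ := G.lift_gen_surjective (b * a⁻¹)
  simpa [hw] using h w a

theorem cayleyGraph_ncard_neighborSet_le (G : MarkedGroup.{v} k) (g : G.carrier) :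
    (G.cayleyGraph.neighborSet g).ncard ≤ 2 * k := by
  have hsub : G.cayleyGraph.neighborSet g ⊆
      Set.range fun p : Fin k ⊕ Fin k =>
        p.elim (fun j => G.gen j * g) fun j => (G.gen j)⁻¹ * g := by
    intro h hh
    rcases (G.cayleyGraph_adj.1 hh).2 with ⟨j, hj⟩ | ⟨j, hj⟩
    · exact ⟨Sum.inl j, hj.symm⟩
    · exact ⟨Sum.inr j, by simp [hj]⟩
  refine (Set.ncard_le_ncard hsub (Set.finite_range _)).trans ?_
  rw [← Set.image_univ]
  refine (Set.ncard_image_le).trans ?_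
  simp [Set.ncard_univ, two_mul]

theorem isBoundedDegreeFamily_cayleyGraph (G : ℕ → MarkedGroup.{v} k)
    (hfin : ∀ m, Finite (G m).carrier) :
    IsBoundedDegreeFamily fun m => (G m).cayleyGraph :=
  ⟨hfin, fun m => (G m).cayleyGraph_connected, max 2 (2 * k), le_max_left _ _, fun m g =>
    ((G m).cayleyGraph_ncard_neighborSet_le g).trans (le_max_right _ _)⟩

theorem cayleyGraph_dist_gen_mul_le (G : MarkedGroup.{v} k) (j : Fin k) (g : G.carrier) :
    G.cayleyGraph.dist g (G.gen j * g) ≤ 1 := by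
  by_cases h : g = G.gen j * g
  · rw [← h]; simp
  · exact (SimpleGraph.dist_eq_one_iff_adj.2 (G.cayleyGraph_adj.2 ⟨h, Or.inl ⟨j, rfl⟩⟩)).le

/-- Multiplication by the value of a word moves the vertices of a Cayley graph by a distance
bounded in terms of the word only. -/
theorem exists_cayleyGraph_dist_lift_mul_le (w : FreeGroup (Fin k)) :
    ∃ B : ℕ, ∀ (G : MarkedGroup.{v} k) (g : G.carrier),
      G.cayleyGraph.dist g (FreeGroup.lift G.gen w * g) ≤ B := by
  induction w using FreeGroup.induction_on with
  | C1 => exact ⟨0, fun G g => by simp⟩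
  | of j => exact ⟨1, fun G g => by simpa using G.cayleyGraph_dist_gen_mul_le j g⟩
  | inv_of j h =>
    obtain ⟨B, hB⟩ := h
    refine ⟨B, fun G g => ?_⟩
    have := hB G ((G.gen j)⁻¹ * g)
    rw [SimpleGraph.dist_comm]
    simpa using this
  | mul x y hx hy =>
    obtain ⟨B, hB⟩ := hx
    obtain ⟨B', hB'⟩ := hy
    refine ⟨B' + B, fun G g => ?_⟩
    rw [map_mul, mul_assoc]
    exact G.cayleyGraph_connected.dist_triangle.trans (add_le_add (hB' G g) (hB G _))

end MarkedGroup

theorem SimpleGraph.Connected.dist_map_le_mul_dist {V W : Type*} {Γ : SimpleGraph V}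
    {Λ : SimpleGraph W} (hΓ : Γ.Connected) (hΛ : Λ.Connected) (ι : W → V) (B : ℕ)
    (h : ∀ v w, Λ.Adj v w → Γ.dist (ι v) (ι w) ≤ B) (v w : W) :
    Γ.dist (ι v) (ι w) ≤ B * Λ.dist v w := by
  obtain ⟨p, hp⟩ := hΛ.exists_walk_length_eq_dist v w
  rw [← hp]
  clear hp
  induction p with
  | nil => simp
  | cons hadj p ih =>
    rw [SimpleGraph.Walk.length_cons, mul_add, mul_one, add_comm]
    exact hΓ.dist_triangle.trans (add_le_add (h _ _ hadj) ih)

namespace MarkedGroup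

/-- The inclusions of the subgroups generated by fixed words are Lipschitz, uniformly over all
marked groups. -/
theorem exists_dist_ofWordsVal_le {k r : ℕ} (w : Fin r → FreeGroup (Fin k)) :
    ∃ B : ℕ, ∀ (G : MarkedGroup.{v} k) (x y : (G.ofWords w).carrier),
      G.cayleyGraph.dist (G.ofWordsVal w x) (G.ofWordsVal w y) ≤
        B * (G.ofWords w).cayleyGraph.dist x y := by
  choose B hB using fun j => exists_cayleyGraph_dist_lift_mul_le.{v} (w j)
  refine ⟨∑ j, B j, fun G => G.cayleyGraph_connected.dist_map_le_mul_dist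
    (G.ofWords w).cayleyGraph_connected _ _ fun x y hxy => ?_⟩
  have hle : ∀ j (x : (G.ofWords w).carrier),
      G.cayleyGraph.dist (G.ofWordsVal w x) (G.ofWordsVal w ((G.ofWords w).gen j * x)) ≤
        ∑ j, B j := by
    intro j x
    rw [map_mul, ofWordsVal_gen]
    exact (hB j G _).trans (Finset.single_le_sum (fun _ _ => Nat.zero_le _) (Finset.mem_univ j))
  rcases ((G.ofWords w).cayleyGraph_adj.1 hxy).2 with ⟨j, rfl⟩ | ⟨j, rfl⟩
  · exact hle j x
  · rw [SimpleGraph.dist_comm]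
    exact hle j y

end MarkedGroup

/-! ### Isometric actions -/

/-- An action of a group by isometries, as a homomorphism to the isometry group. -/
def isometryHom {A X : Type*} [Group A] [PseudoEMetricSpace X] (act : A → X → X)
    (h_one : ∀ x, act 1 x = x) (h_mul : ∀ a b x, act (a * b) x = act a (act b x))
    (h_iso : ∀ a, Isometry (act a)) : A →* (X ≃ᵢ X) where
  toFun a :=
    { toFun := act a
      invFun := act a⁻¹
      left_inv := fun x => by rw [← h_mul, inv_mul_cancel, h_one]
      right_inv := fun x => by rw [← h_mul, mul_inv_cancel, h_one]
      isometry_toFun := h_iso a }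
  map_one' := by ext x; exact h_one x
  map_mul' a b := by ext x; exact h_mul a b x

@[simp]
theorem isometryHom_apply {A X : Type*} [Group A] [PseudoEMetricSpace X] (act : A → X → X)
    (h_one : ∀ x, act 1 x = x) (h_mul : ∀ a b x, act (a * b) x = act a (act b x))
    (h_iso : ∀ a, Isometry (act a)) (a : A) (x : X) :
    isometryHom act h_one h_mul h_iso a x = act a x :=
  rfl

theorem PropertyF.exists_fixedPoint {𝕜 : Type*} [RCLike 𝕜] {𝓔 : Set (BanachSp.{u} 𝕜)}
    {H : Type*} [Group H] (hF : PropertyF 𝓔 H) {X : Type*} [NormedAddCommGroup X]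
    [NormedSpace 𝕜 X] (hX : ContainsSpace 𝓔 X) (α : H →* (X ≃ᵢ X)) :
    ∃ x : X, ∀ h, α h x = x := by
  obtain ⟨F, hF𝓔, ⟨e⟩⟩ := hX
  obtain ⟨x, hx⟩ := hF F hF𝓔 (isometryHom (fun h y => e.symm (α h (e y)))
    (fun y => by simp) (fun a b y => by simp)
    fun a => e.symm.isometry.comp ((α a).isometry.comp e.isometry))
  refine ⟨e x, fun h => e.symm.injective ?_⟩
  simpa using hx h

theorem PropertyF.of_mulEquiv {𝕜 : Type*} [RCLike 𝕜] {𝓔 : Set (BanachSp.{u} 𝕜)}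
    {H K : Type*} [Group H] [Group K] (e : H ≃* K) (hF : PropertyF 𝓔 H) : PropertyF 𝓔 K := by
  intro E hE α
  obtain ⟨x, hx⟩ := hF E hE (α.comp e.toMonoidHom)
  exact ⟨x, fun h => by simpa using hx (e.symm h)⟩

/-! ### Permutation representations on `ℓ_p`-spaces -/

section Reindex

variable {𝕜 : Type*} [RCLike 𝕜] {ι κ E : Type*} [NormedAddCommGroup E] [NormedSpace 𝕜 E]
  {p : ℝ≥0∞} [hp : Fact (1 ≤ p)]

theorem toReal_pos_of_fact (hp_top : p ≠ ∞) : 0 < p.toReal :=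
  ENNReal.toReal_pos (zero_lt_one.trans_le hp.out).ne' hp_top

theorem memℓp_comp_equiv (hp_top : p ≠ ∞) (e : κ ≃ ι) (f : ι → E)
    (hf : Memℓp (E := fun _ : ι => E) f p) : Memℓp (E := fun _ : κ => E) (fun i => f (e i)) p := by
  have h0 := toReal_pos_of_fact hp_top
  rw [memℓp_gen_iff h0] at hf ⊢
  exact hf.comp_injective e.injective

variable (𝕜 E) in
/-- Reindexing an `ℓ_p`-space along a bijection of the index sets. -/
noncomputable def lpReindex (hp_top : p ≠ ∞) (e : ι ≃ κ) :
    lp (fun _ : ι => E) p ≃ₗᵢ[𝕜] lp (fun _ : κ => E) p where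
  toFun f := ⟨fun i => f (e.symm i), memℓp_comp_equiv hp_top e.symm _ (lp.memℓp f)⟩
  invFun f := ⟨fun i => f (e i), memℓp_comp_equiv hp_top e _ (lp.memℓp f)⟩
  map_add' f g := rfl
  map_smul' c f := rfl
  left_inv f := by ext i; simp
  right_inv f := by ext i; simp
  norm_map' f := by
    have h0 := toReal_pos_of_fact hp_top
    rw [lp.norm_eq_tsum_rpow h0, lp.norm_eq_tsum_rpow h0]
    congr 1
    exact e.symm.tsum_eq fun i => ‖f i‖ ^ p.toReal

variable (𝕜 ι E) in
/-- The permutation representation on an `ℓ_p`-space over a set with a group action. -/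
noncomputable def lpRep (hp_top : p ≠ ∞) (A : Type*) [Group A] [MulAction A ι] :
    A →* (lp (fun _ : ι => E) p ≃ₗᵢ[𝕜] lp (fun _ : ι => E) p) where
  toFun a := lpReindex 𝕜 E hp_top (MulAction.toPerm a)
  map_one' := by
    ext f i
    change f ((MulAction.toPerm (1 : A)).symm i) = f i
    simp
  map_mul' a b := by
    ext f i
    change f ((MulAction.toPerm (a * b)).symm i) =
      f ((MulAction.toPerm b).symm ((MulAction.toPerm a).symm i))
    simp [mul_smul]

@[simp]
theorem lpRep_apply (hp_top : p ≠ ∞) {A : Type*} [Group A] [MulAction A ι] (a : A)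
    (f : lp (fun _ : ι => E) p) (i : ι) : lpRep 𝕜 ι E hp_top A a f i = f (a⁻¹ • i) :=
  rfl

theorem ContainsSpace.lp_of_countable {𝓔 : Set (BanachSp.{u} 𝕜)} (hp_top : p ≠ ∞)
    (h : ContainsSpace 𝓔 (lp (fun _ : ℕ => E) p)) [Countable ι] [Infinite ι] :
    ContainsSpace 𝓔 (lp (fun _ : ι => E) p) := by
  obtain ⟨F, hF, ⟨e⟩⟩ := h
  obtain ⟨e'⟩ := nonempty_equiv_of_countable (α := ℕ) (β := ι)
  exact ⟨F, hF, ⟨e.trans (lpReindex 𝕜 E hp_top e')⟩⟩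

theorem lp_finite_setOf_le_norm (hp_top : p ≠ ∞) (f : lp (fun _ : ι => E) p) {c : ℝ}
    (hc : 0 < c) : {i | c ≤ ‖f i‖}.Finite := by
  have h0 := toReal_pos_of_fact hp_top
  have hs : Summable fun i => ‖f i‖ ^ p.toReal := (memℓp_gen_iff h0).1 (lp.memℓp f)
  have ht := hs.tendsto_cofinite_zero.eventually (gt_mem_nhds (Real.rpow_pos_of_pos hc p.toReal))
  refine (mem_cofinite.1 ht).subset fun i hi => ?_
  simpa using Real.rpow_le_rpow hc.le hi h0.le

end Reindex

/-! ### Finite generation -/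

/-- A countable group that has the fixed point property for `ℓ_p(ℕ, E)`, `E ≠ 0`, is finitely
generated. Otherwise it is the union of a sequence of proper finitely generated subgroups `H_n`;
the bounded function on the disjoint union of the coset spaces `H / H_n` that is a fixed nonzero
vector at each base coset and `0` elsewhere is moved by each group element only at finitely many
places, and the affine action on `ℓ_p` that it defines has no fixed point. -/
theorem fg_of_propertyF {𝕜 : Type*} [RCLike 𝕜] {𝓔 : Set (BanachSp.{u} 𝕜)} {H : Type*} [Group H]
    [Countable H] (hF : PropertyF 𝓔 H) {E : Type*} [NormedAddCommGroup E] [NormedSpace 𝕜 E]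
    [Nontrivial E] {p : ℝ≥0∞} [hp : Fact (1 ≤ p)] (hp_top : p ≠ ∞)
    (hE : ContainsSpace 𝓔 (lp (fun _ : ℕ => E) p)) : Group.FG H := by
  classical
  by_contra hfg
  obtain ⟨f, hf⟩ := exists_surjective_nat H
  let S : ℕ → Subgroup H := fun n => Subgroup.closure (f '' Set.Iic n)
  have hS : ∀ n, S n ≠ ⊤ := fun n h =>
    hfg (Group.fg_iff.2 ⟨_, h, (Set.finite_Iic n).image f⟩)
  obtain ⟨e, he⟩ := exists_ne (0 : E)
  -- `ξ` is not in `ℓ_p`, but the differences `h • ξ - ξ` have finite support, since `h` fixes the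
  -- base coset of `S n` for all large `n`.
  let ξ : (Σ n, H ⧸ S n) → E := fun i => if i.2 = ((1 : H) : H ⧸ S i.1) then e else 0
  have hfin : ∀ h : H, {i : Σ n, H ⧸ S n | ξ (h⁻¹ • i) - ξ i ≠ 0}.Finite := by
    intro h
    obtain ⟨N, rfl⟩ := hf h
    have hfin' : (⋃ n ∈ Set.Iio N,
        ({⟨n, ((1 : H) : H ⧸ S n)⟩, ⟨n, (f N : H ⧸ S n)⟩} : Set (Σ n, H ⧸ S n))).Finite :=
      (Set.finite_Iio N).biUnion fun n _ => (Set.finite_singleton _).insert _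
    refine hfin'.subset ?_
    rintro ⟨n, c⟩ hc
    have hsmul : (f N)⁻¹ • c = ((1 : H) : H ⧸ S n) ↔ c = (f N : H ⧸ S n) := by
      rw [inv_smul_eq_iff, MulAction.Quotient.smul_coe, smul_eq_mul, mul_one]
    have hc' : (if c = (f N : H ⧸ S n) then e else 0) -
        (if c = ((1 : H) : H ⧸ S n) then e else 0) ≠ 0 := by
      have h1 : ξ ((f N)⁻¹ • ⟨n, c⟩) = if c = (f N : H ⧸ S n) then e else 0 := by
        rw [← if_congr hsmul rfl rfl]; rfl
      rw [← h1]
      exact hc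
    have hn : n < N := by
      by_contra hn
      have hmem : f N ∈ S n := Subgroup.subset_closure ⟨N, not_lt.1 hn, rfl⟩
      have : (f N : H ⧸ S n) = ((1 : H) : H ⧸ S n) := by
        rw [eq_comm, QuotientGroup.eq]; simpa using hmem
      rw [this] at hc'
      exact hc' (sub_self _)
    refine Set.mem_biUnion hn ?_
    by_contra hcon
    simp only [Set.mem_insert_iff, Set.mem_singleton_iff, Sigma.mk.injEq, heq_eq_eq, true_and,
      not_or] at hcon
    rw [if_neg hcon.1, if_neg hcon.2] at hc'
    exact hc' (sub_self _)
  let b : H → lp (fun _ : (Σ n, H ⧸ S n) => E) p := fun h =>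
    ⟨fun i => ξ (h⁻¹ • i) - ξ i, (memℓp_zero (hfin h)).of_exponent_ge zero_le⟩
  have hb : ∀ h i, b h i = ξ (h⁻¹ • i) - ξ i := fun _ _ => rfl
  have : ∀ n, Countable (H ⧸ S n) := fun n => (QuotientGroup.mk_surjective (s := S n)).countable
  have : Infinite (Σ n, H ⧸ S n) :=
    Infinite.of_injective (fun n => (⟨n, ((1 : H) : H ⧸ S n)⟩ : Σ n, H ⧸ S n))
      fun m n hmn => congrArg Sigma.fst hmn
  obtain ⟨x, hx⟩ := hF.exists_fixedPoint
    (hE.lp_of_countable (ι := Σ n, H ⧸ S n) hp_top)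
    (isometryHom (fun h y => lpRep 𝕜 (Σ n, H ⧸ S n) E hp_top H h y + b h)
      (fun y => by ext i; simp [hb])
      (fun g h y => by
        ext i
        simp only [lp.coeFn_add, Pi.add_apply, lpRep_apply, hb, mul_inv_rev, mul_smul]
        abel)
      fun h => (isometry_add_right (b h)).comp (lpRep 𝕜 _ E hp_top H h).isometry)
  have hinv : ∀ (h : H) i, x (h⁻¹ • i) + ξ (h⁻¹ • i) = x i + ξ i := by
    intro h i
    have := congrArg (fun y : lp (fun _ : (Σ n, H ⧸ S n) => E) p => y i) (hx h)
    simp only [isometryHom_apply, lp.coeFn_add, Pi.add_apply, lpRep_apply, hb] at this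
    rw [← add_sub_assoc, sub_eq_iff_eq_add] at this
    exact this
  -- As `x + ξ` is constant on each `H / H_n`, two values of `x` there differ by `e`.
  have hlarge : ∀ n, ∃ c : H ⧸ S n, ‖e‖ / 2 ≤ ‖x ⟨n, c⟩‖ := by
    intro n
    obtain ⟨h, hh⟩ : ∃ h, h ∉ S n := by
      by_contra hcon
      push Not at hcon
      exact hS n (eq_top_iff.2 fun h _ => hcon h)
    by_contra hcon
    push Not at hcon
    have hne : (h : H ⧸ S n) ≠ ((1 : H) : H ⧸ S n) := by
      rw [ne_comm, Ne, QuotientGroup.eq]; simpa using hh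
    have h1 := hinv h⁻¹ ⟨n, ((1 : H) : H ⧸ S n)⟩
    have h2 : (h⁻¹)⁻¹ • (⟨n, ((1 : H) : H ⧸ S n)⟩ : Σ n, H ⧸ S n) = ⟨n, (h : H ⧸ S n)⟩ := by
      rw [inv_inv]
      change (⟨n, h • ((1 : H) : H ⧸ S n)⟩ : Σ n, H ⧸ S n) = _
      rw [MulAction.Quotient.smul_coe, smul_eq_mul, mul_one]
    rw [h2] at h1
    have h3 : ξ ⟨n, (h : H ⧸ S n)⟩ = 0 := if_neg hne
    have h4 : ξ ⟨n, ((1 : H) : H ⧸ S n)⟩ = e := if_pos rfl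
    rw [h3, h4, add_zero] at h1
    have h5 : e = x ⟨n, (h : H ⧸ S n)⟩ - x ⟨n, ((1 : H) : H ⧸ S n)⟩ := by rw [h1]; abel
    have h6 := norm_sub_le (x ⟨n, (h : H ⧸ S n)⟩) (x ⟨n, ((1 : H) : H ⧸ S n)⟩)
    rw [← h5] at h6
    linarith [hcon (h : H ⧸ S n), hcon ((1 : H) : H ⧸ S n)]
  choose c hc using hlarge
  refine Set.infinite_range_of_injective (f := fun n => (⟨n, c n⟩ : Σ n, H ⧸ S n))
    (fun m n hmn => congrArg Sigma.fst hmn) ?_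
  refine (lp_finite_setOf_le_norm hp_top x (half_pos (norm_pos_iff.2 he))).subset ?_
  rintro _ ⟨n, rfl⟩
  exact hc n

/-! ### Points of almost minimal displacement -/

/-- If `δ` has no zero close to `x`, in terms of `δ x`, then some point almost minimizes `δ` in a
ball about it whose radius is a given multiple of the value there: otherwise iterated improvement
yields a Cauchy sequence that converges to a zero of `δ`. -/
theorem exists_almost_minimal {X : Type*} [PseudoMetricSpace X] [CompleteSpace X] {δ : X → ℝ}
    (hδ : Continuous δ) (h_nonneg : ∀ x, 0 ≤ δ x) {K : ℝ} (hK : 0 ≤ K) (x : X)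
    (hx : ∀ y, δ y = 0 → 2 * K * δ x < dist x y) :
    ∃ y, 0 < δ y ∧ ∀ z, dist z y ≤ K * δ y → δ y / 2 ≤ δ z := by
  by_contra! hcon
  have step : ∀ y, ∃ z, dist z y ≤ K * δ y ∧ δ z ≤ δ y / 2 := by
    intro y
    rcases (h_nonneg y).eq_or_lt with h | h
    · exact ⟨y, by simp [← h], by simp [← h]⟩
    · obtain ⟨z, hz, hz'⟩ := hcon y h
      exact ⟨z, hz, hz'.le⟩
  choose g hg hg' using step
  have hval : ∀ n, δ (g^[n] x) ≤ δ x / 2 ^ n := by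
    intro n
    induction n with
    | zero => simp
    | succ n ih =>
      rw [Function.iterate_succ_apply', pow_succ, ← div_div]
      exact (hg' _).trans (by gcongr)
  have hdist : ∀ n, dist (g^[n] x) (g^[n + 1] x) ≤ 2 * K * δ x / 2 / 2 ^ n := by
    intro n
    rw [Function.iterate_succ_apply', dist_comm]
    refine (hg _).trans ((mul_le_mul_of_nonneg_left (hval n) hK).trans_eq ?_)
    ring
  obtain ⟨y, hy⟩ := cauchySeq_tendsto_of_complete (cauchySeq_of_le_geometric_two hdist)
  have hy0 : δ y = 0 := by
    refine tendsto_nhds_unique ((hδ.tendsto y).comp hy)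
      (squeeze_zero (fun n => h_nonneg _) hval ?_)
    simpa [div_eq_mul_inv] using (tendsto_pow_atTop_nhds_zero_of_lt_one
      (by norm_num : (0 : ℝ) ≤ 1 / 2) (by norm_num)).const_mul (δ x)
  exact (hx y hy0).not_ge (dist_le_of_le_geometric_two_of_tendsto₀ hdist hy)

section Displacement

variable {𝕜 : Type*} [RCLike 𝕜] {X : Type*} [NormedAddCommGroup X] [NormedSpace 𝕜 X]
  {A : Type*} [Group A] {r : ℕ}

/-- The total displacement of a vector by the elements `s_1, …, s_r` of a group that acts by
linear isometries. -/
noncomputable def displacement (ρ : A →* (X ≃ₗᵢ[𝕜] X)) (s : Fin r → A) (x : X) : ℝ :=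
  ∑ j, ‖ρ (s j) x - x‖

theorem displacement_nonneg (ρ : A →* (X ≃ₗᵢ[𝕜] X)) (s : Fin r → A) (x : X) :
    0 ≤ displacement ρ s x :=
  Finset.sum_nonneg fun _ _ => norm_nonneg _

theorem continuous_displacement (ρ : A →* (X ≃ₗᵢ[𝕜] X)) (s : Fin r → A) :
    Continuous (displacement ρ s) :=
  continuous_finsetSum _ fun j _ => ((ρ (s j)).continuous.sub continuous_id).norm

theorem displacement_smul (ρ : A →* (X ≃ₗᵢ[𝕜] X)) (s : Fin r → A) (c : 𝕜) (x : X) :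
    displacement ρ s (c • x) = ‖c‖ * displacement ρ s x := by
  simp only [displacement, Finset.mul_sum, map_smul, ← smul_sub, norm_smul]

theorem displacement_eq_zero_iff (ρ : A →* (X ≃ₗᵢ[𝕜] X)) (s : Fin r → A) (x : X) :
    displacement ρ s x = 0 ↔ ∀ j, ρ (s j) x = x := by
  simp [displacement, Finset.sum_eq_zero_iff_of_nonneg, sub_eq_zero]

/-- The linear case of `exists_almost_minimal`, where the point found can be rescaled to have
displacement `1`. -/
theorem exists_displacement_eq_one [CompleteSpace X] (ρ : A →* (X ≃ₗᵢ[𝕜] X)) (s : Fin r → A)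
    {K : ℝ} (hK : 0 ≤ K) (x : X)
    (hx : ∀ y, (∀ j, ρ (s j) y = y) → 2 * K * displacement ρ s x < ‖x - y‖) :
    ∃ y, displacement ρ s y = 1 ∧ ∀ z, ‖z - y‖ ≤ K → 1 / 2 ≤ displacement ρ s z := by
  obtain ⟨y, hy, hmin⟩ := exists_almost_minimal (continuous_displacement ρ s)
    (displacement_nonneg ρ s) hK x fun y hy => by
      rw [dist_eq_norm]; exact hx y ((displacement_eq_zero_iff ρ s y).1 hy)
  set d := displacement ρ s y with hd
  have hd𝕜 : (d : 𝕜) ≠ 0 := by exact_mod_cast hy.ne'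
  have hnorm : ‖(d : 𝕜)‖ = d := by rw [RCLike.norm_ofReal, abs_of_pos hy]
  refine ⟨(d : 𝕜)⁻¹ • y, ?_, fun z hz => ?_⟩
  · rw [displacement_smul, norm_inv, hnorm, ← hd, inv_mul_cancel₀ hy.ne']
  · have h1 : dist ((d : 𝕜) • z) y ≤ K * d := by
      have h2 : (d : 𝕜) • z - y = (d : 𝕜) • (z - (d : 𝕜)⁻¹ • y) := by
        rw [smul_sub, smul_inv_smul₀ hd𝕜]
      rw [dist_eq_norm, h2, norm_smul, hnorm, mul_comm]
      gcongr
    have h3 := hmin _ h1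
    rw [displacement_smul, hnorm] at h3
    by_contra! hlt
    nlinarith

/-- Transport of a linear isometric representation along a linear isometry. -/
noncomputable def conjRep {Y : Type*} [NormedAddCommGroup Y] [NormedSpace 𝕜 Y] (e : X ≃ₗᵢ[𝕜] Y)
    (ρ : A →* (X ≃ₗᵢ[𝕜] X)) : A →* (Y ≃ₗᵢ[𝕜] Y) where
  toFun a := (e.symm.trans (ρ a)).trans e
  map_one' := by ext y; simp
  map_mul' a b := by ext y; simp

theorem displacement_conjRep {Y : Type*} [NormedAddCommGroup Y] [NormedSpace 𝕜 Y]
    (e : X ≃ₗᵢ[𝕜] Y) (ρ : A →* (X ≃ₗᵢ[𝕜] X)) (s : Fin r → A) (y : Y) :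
    displacement (conjRep e ρ) s y = displacement ρ s (e.symm y) := by
  refine Finset.sum_congr rfl fun j _ => ?_
  rw [← e.symm.norm_map]
  simp [conjRep]

end Displacement

/-! ### Limit actions on ultraproducts -/

/-- An action by isometries on a pseudometric space, as an action on the associated metric
space. -/
noncomputable def isometryHomQuotient {A X : Type*} [Group A] [PseudoMetricSpace X]
    (act : A → X → X) (h_one : ∀ x, act 1 x = x)
    (h_mul : ∀ a b x, act (a * b) x = act a (act b x)) (h_iso : ∀ a, Isometry (act a)) :
    A →* (SeparationQuotient X ≃ᵢ SeparationQuotient X) :=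
  isometryHom
    (fun a => SeparationQuotient.lift (fun x => SeparationQuotient.mk (act a x)) fun _ _ h =>
      SeparationQuotient.mk_eq_mk.2 (h.map (h_iso a).continuous))
    (fun x => by
      obtain ⟨x, rfl⟩ := SeparationQuotient.surjective_mk x
      simp [h_one])
    (fun a b x => by
      obtain ⟨x, rfl⟩ := SeparationQuotient.surjective_mk x
      simp [h_mul])
    fun a => Isometry.of_dist_eq fun x y => by
      obtain ⟨x, rfl⟩ := SeparationQuotient.surjective_mk x
      obtain ⟨y, rfl⟩ := SeparationQuotient.surjective_mk y
      simp [SeparationQuotient.dist_mk, (h_iso a).dist_eq]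

namespace UltraBounded

variable {𝓤 : Ultrafilter ℕ} {E : ℕ → Type u} [∀ m, NormedAddCommGroup (E m)]

/-- A bounded sequence as an element of `UltraBounded`. -/
def ofBounded (x : ∀ m, E m) (h : ∃ C, ∀ m, ‖x m‖ ≤ C) : UltraBounded 𝓤 E :=
  (⟨x, memℓp_infty (by
    obtain ⟨C, hC⟩ := h
    exact ⟨C, by rintro _ ⟨m, rfl⟩; exact hC m⟩)⟩ : lp E ∞)

theorem ext_coord {x y : UltraBounded 𝓤 E} (h : ∀ m, x.coord m = y.coord m) : x = y :=
  lp.ext (funext h)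

theorem exists_norm_coord_le (x : UltraBounded 𝓤 E) : ∃ C, ∀ m, ‖x.coord m‖ ≤ C :=
  ⟨‖x.toLp‖, lp.norm_apply_le_norm ENNReal.top_ne_zero x.toLp⟩

theorem tendsto_dist (x y : UltraBounded 𝓤 E) :
    Tendsto (fun m => ‖x.coord m - y.coord m‖) (𝓤 : Filter ℕ) (𝓝 (dist x y)) := by
  rw [dist_eq_norm]
  exact tendsto_norm (x - y)

end UltraBounded

/-- Linear isometric actions of the approximating groups on a Banach space, with base points moved
by the generators by a bounded amount, have a limit: an affine isometric action of the limit group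
on the ultraproduct, re-based at the base points. It has no fixed point when the displacement is
bounded below on balls about the base points with radii tending to infinity. -/
theorem exists_limit_action_without_fixedPoint {𝕜 : Type*} [RCLike 𝕜] {r : ℕ}
    {K : ℕ → MarkedGroup.{v} r} {K_lim : MarkedGroup.{v} r}
    (hlim : ∀ w : FreeGroup (Fin r), ∀ᶠ n in atTop,
      (FreeGroup.lift (K n).gen w = 1 ↔ FreeGroup.lift K_lim.gen w = 1))
    {F : Type u} [NormedAddCommGroup F] [NormedSpace 𝕜 F] (𝓤 : Ultrafilter ℕ)
    (h𝓤 : (𝓤 : Filter ℕ) ≤ cofinite) (β : ∀ n, (K n).carrier →* (F ≃ₗᵢ[𝕜] F)) (y : ℕ → F)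
    (hy : ∀ n, displacement (β n) (K n).gen (y n) = 1)
    (hmin : ∀ (n : ℕ) z, ‖z - y n‖ ≤ n → 1 / 2 ≤ displacement (β n) (K n).gen z) :
    ∃ α : K_lim.carrier →*
        (BanachUltraproduct 𝓤 (fun _ => F) ≃ᵢ BanachUltraproduct 𝓤 (fun _ => F)),
      ∀ x, ∃ g, α g x ≠ x := by
  rw [Nat.cofinite_eq_atTop] at h𝓤
  -- The base points are moved by a bounded amount by every word, so that
  -- `x ↦ (w (x_n + y_n) - y_n)_n` preserves bounded sequences.
  have hbound : ∀ w : FreeGroup (Fin r), ∃ C, ∀ n,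
      ‖β n (FreeGroup.lift (K n).gen w) (y n) - y n‖ ≤ C := by
    intro w
    induction w using FreeGroup.induction_on with
    | C1 => exact ⟨0, fun n => by simp⟩
    | of j =>
      refine ⟨1, fun n => ?_⟩
      rw [FreeGroup.lift_apply_of, ← hy n]
      exact Finset.single_le_sum (f := fun j => ‖β n ((K n).gen j) (y n) - y n‖)
        (fun _ _ => norm_nonneg _) (Finset.mem_univ j)
    | inv_of j h =>
      obtain ⟨C, hC⟩ := h
      refine ⟨C, fun n => ?_⟩
      rw [← (β n (FreeGroup.lift (K n).gen (FreeGroup.of j))).norm_map, map_sub,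
        norm_sub_rev]
      simpa using hC n
    | mul a b ha hb =>
      obtain ⟨C, hC⟩ := ha
      obtain ⟨C', hC'⟩ := hb
      refine ⟨C' + C, fun n => ?_⟩
      refine (norm_sub_le_norm_sub_add_norm_sub _
        (β n (FreeGroup.lift (K n).gen a) (y n)) _).trans (add_le_add ?_ (hC n))
      rw [map_mul, map_mul, LinearIsometryEquiv.coe_mul, Function.comp_apply, ← map_sub,
        LinearIsometryEquiv.norm_map]
      exact hC' n
  have hbound' : ∀ (w : FreeGroup (Fin r)) (x : UltraBounded 𝓤 (fun _ => F)), ∃ C, ∀ n,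
      ‖β n (FreeGroup.lift (K n).gen w) (x.coord n + y n) - y n‖ ≤ C := by
    intro w x
    obtain ⟨C, hC⟩ := hbound w
    obtain ⟨C', hC'⟩ := x.exists_norm_coord_le
    refine ⟨C' + C, fun n => ?_⟩
    rw [map_add, add_sub_assoc]
    refine (norm_add_le _ _).trans (add_le_add ?_ (hC n))
    rw [LinearIsometryEquiv.norm_map]
    exact hC' n
  let act : FreeGroup (Fin r) → UltraBounded 𝓤 (fun _ => F) → UltraBounded 𝓤 (fun _ => F) :=
    fun w x => UltraBounded.ofBounded
      (fun n => β n (FreeGroup.lift (K n).gen w) (x.coord n + y n) - y n) (hbound' w x)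
  have hact : ∀ w x n, (act w x).coord n =
      β n (FreeGroup.lift (K n).gen w) (x.coord n + y n) - y n := fun _ _ _ => rfl
  have h_iso : ∀ w, Isometry (act w) := fun w => Isometry.of_dist_eq fun x z => by
    refine tendsto_nhds_unique ((act w x).tendsto_dist (act w z))
      ((x.tendsto_dist z).congr fun n => ?_)
    rw [hact, hact, sub_sub_sub_cancel_right, ← map_sub, LinearIsometryEquiv.norm_map,
      add_sub_add_right_eq_sub]
  let α₀ := isometryHomQuotient act
    (fun x => UltraBounded.ext_coord fun n => by simp [hact])
    (fun a b x => UltraBounded.ext_coord fun n => by simp [hact]) h_iso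
  -- Relations of the limit group hold in almost all `K n`, hence act trivially.
  have hker : (FreeGroup.lift K_lim.gen).ker ≤ α₀.ker := by
    intro w hw
    rw [MonoidHom.mem_ker] at hw ⊢
    ext x
    obtain ⟨x, rfl⟩ := SeparationQuotient.surjective_mk x
    refine SeparationQuotient.mk_eq_mk.2 (Metric.inseparable_iff.2 ?_)
    refine tendsto_nhds_unique ((act w x).tendsto_dist x) (tendsto_const_nhds.congr' ?_)
    filter_upwards [h𝓤 (hlim w)] with n hn
    simp [hact, hn.2 hw]
  obtain ⟨σ, hσ⟩ := K_lim.lift_gen_surjective.hasRightInverse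
  refine ⟨(FreeGroup.lift K_lim.gen).liftOfRightInverse σ hσ ⟨α₀, hker⟩, fun x => ?_⟩
  obtain ⟨x, rfl⟩ := SeparationQuotient.surjective_mk x
  by_contra! hcon
  have hzero : Tendsto (fun n => displacement (β n) (K n).gen (x.coord n + y n))
      (𝓤 : Filter ℕ) (𝓝 0) := by
    have hj : ∀ j : Fin r, Tendsto
        (fun n => ‖β n ((K n).gen j) (x.coord n + y n) - (x.coord n + y n)‖)
        (𝓤 : Filter ℕ) (𝓝 0) := by
      intro j
      have h := hcon (FreeGroup.lift K_lim.gen (FreeGroup.of j))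
      rw [MonoidHom.liftOfRightInverse_comp_apply] at h
      have h' := Metric.inseparable_iff.1 (SeparationQuotient.mk_eq_mk.1 h)
      rw [← h']
      refine ((act (FreeGroup.of j) x).tendsto_dist x).congr fun n => ?_
      rw [hact, FreeGroup.lift_apply_of, sub_sub, add_comm (y n)]
    simpa [displacement] using tendsto_finsetSum Finset.univ fun j _ => hj j
  obtain ⟨C, hC⟩ := x.exists_norm_coord_le
  obtain ⟨n, hn, hn'⟩ := ((hzero.eventually (gt_mem_nhds (by norm_num : (0 : ℝ) < 1 / 2))).and
    (h𝓤 (eventually_ge_atTop ⌈C⌉₊))).exists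
  refine hn.not_ge (hmin n _ ?_)
  rw [add_sub_cancel_right]
  exact (hC n).trans ((Nat.le_ceil C).trans (by exact_mod_cast hn'))

/-! ### Poincaré inequalities on finite graphs -/

section Graph

variable {W E : Type*} [NormedAddCommGroup E]

theorem edgeEnergy_mk (q : ℝ) (f : W → E) (v w : W) :
    edgeEnergy q f s(v, w) = ‖f v - f w‖ ^ q :=
  rfl

theorem edgeEnergy_nonneg (q : ℝ) (f : W → E) (e : Sym2 W) : 0 ≤ edgeEnergy q f e := by
  induction e with
  | h v w => exact Real.rpow_nonneg (norm_nonneg _) q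

/-- In the sum over the vertices each edge `{v, s v}` occurs at most twice. -/
theorem sum_norm_sub_rpow_le_two_mul_sum_edgeEnergy [Fintype W] (Λ : SimpleGraph W)
    [Fintype Λ.edgeSet] {q : ℝ} (hq : 0 < q) (s : W → W) (hs : ∀ v, v ≠ s v → Λ.Adj v (s v))
    (f : W → E) :
    ∑ v, ‖f v - f (s v)‖ ^ q ≤ 2 * ∑ e ∈ Λ.edgeFinset, edgeEnergy q f e := by
  classical
  have h1 : ∑ v, ‖f v - f (s v)‖ ^ q =
      ∑ v with v ≠ s v, edgeEnergy q f s(v, s v) := by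
    rw [Finset.sum_filter]
    refine Finset.sum_congr rfl fun v _ => ?_
    split_ifs with h
    · rfl
    · rw [← not_not.1 h, sub_self, norm_zero, Real.zero_rpow hq.ne']
  -- Group the vertices by the edge `{v, s v}`: only `v ∈ {a, b}` can give `{a, b}`.
  rw [h1, Finset.sum_comp (edgeEnergy q f) fun v => s(v, s v), Finset.mul_sum]
  refine (Finset.sum_le_sum fun e _ => ?_).trans
    (Finset.sum_le_sum_of_subset_of_nonneg ?_ fun e _ _ =>
      mul_nonneg zero_le_two (edgeEnergy_nonneg q f e))
  · rw [nsmul_eq_mul]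
    refine mul_le_mul_of_nonneg_right ?_ (edgeEnergy_nonneg q f e)
    induction e with
    | h a b =>
      have hsub : (Finset.univ.filter fun v => v ≠ s v).filter (fun v => s(v, s v) = s(a, b)) ⊆
          {a, b} := by
        intro v hv
        have := (Finset.mem_filter.1 hv).2
        rw [Sym2.eq_iff] at this
        simp only [Finset.mem_insert, Finset.mem_singleton]
        tauto
      exact_mod_cast (Finset.card_le_card hsub).trans Finset.card_le_two
  · intro e he
    obtain ⟨v, hv, rfl⟩ := Finset.mem_image.1 he
    rw [SimpleGraph.mem_edgeFinset, SimpleGraph.mem_edgeSet]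
    exact hs v (Finset.mem_filter.1 hv).2

theorem norm_sub_le_dist_mul_of_adj {Λ : SimpleGraph W} (hΛ : Λ.Connected) (f : W → E) {M : ℝ}
    (h : ∀ v w, Λ.Adj v w → ‖f v - f w‖ ≤ M) (v w : W) :
    ‖f v - f w‖ ≤ Λ.dist v w * M := by
  obtain ⟨p, hp⟩ := hΛ.exists_walk_length_eq_dist v w
  rw [← hp]
  clear hp
  induction p with
  | nil => simp
  | cons hadj p ih =>
    rw [SimpleGraph.Walk.length_cons, Nat.cast_succ, add_mul, one_mul, add_comm]
    exact (norm_sub_le_norm_sub_add_norm_sub _ _ _).trans (add_le_add (h _ _ hadj) ih)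

variable {𝕜 : Type*} [RCLike 𝕜] [NormedSpace 𝕜 E]

variable (𝕜) in
theorem norm_mean_sub_le [Fintype W] [Nonempty W] (f : W → E) (c : E) :
    ‖(Fintype.card W : 𝕜)⁻¹ • ∑ w, f w - c‖ ≤ ∑ w, (Fintype.card W : ℝ)⁻¹ * ‖f w - c‖ := by
  have hN : (Fintype.card W : 𝕜) ≠ 0 := by exact_mod_cast Fintype.card_ne_zero
  have h : (Fintype.card W : 𝕜)⁻¹ • ∑ w, f w - c = (Fintype.card W : 𝕜)⁻¹ • ∑ w, (f w - c) := by
    rw [Finset.sum_sub_distrib, Finset.sum_const, Finset.card_univ, smul_sub,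
      ← Nat.cast_smul_eq_nsmul 𝕜, inv_smul_smul₀ hN]
  rw [h, norm_smul, norm_inv, RCLike.norm_natCast, ← Finset.mul_sum]
  gcongr
  exact norm_sum_le _ _

variable (𝕜) in
/-- The mean minimizes the `ℓ_q`-distance to the constants up to a factor `2`. -/
theorem sum_norm_sub_mean_rpow_le [Fintype W] [Nonempty W] {q : ℝ} (hq : 1 ≤ q) (f : W → E)
    (c : E) :
    ∑ v, ‖f v - (Fintype.card W : 𝕜)⁻¹ • ∑ w, f w‖ ^ q ≤ 2 ^ q * ∑ v, ‖f v - c‖ ^ q := by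
  have hN : (Fintype.card W : ℝ) ≠ 0 := by exact_mod_cast Fintype.card_ne_zero
  have hN0 : 0 ≤ (Fintype.card W : ℝ)⁻¹ := by positivity
  set m := (Fintype.card W : 𝕜)⁻¹ • ∑ w, f w with hm
  have h1 : ‖m - c‖ ^ q ≤ (Fintype.card W : ℝ)⁻¹ * ∑ v, ‖f v - c‖ ^ q := by
    rw [Finset.mul_sum]
    refine (Real.rpow_le_rpow (norm_nonneg _) (norm_mean_sub_le 𝕜 f c) (by linarith)).trans ?_
    exact Real.rpow_arith_mean_le_arith_mean_rpow _ _ _ (fun _ _ => hN0)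
      (by simp [hN]) (fun _ _ => norm_nonneg _) hq
  have h2 : ∀ v, ‖f v - m‖ ^ q ≤ 2 ^ (q - 1) * (‖f v - c‖ ^ q + ‖m - c‖ ^ q) := by
    intro v
    refine (Real.rpow_le_rpow (norm_nonneg _)
      ((norm_sub_le_norm_sub_add_norm_sub (f v) c m).trans_eq (by rw [norm_sub_rev c m]))
      (by linarith)).trans ?_
    exact_mod_cast NNReal.rpow_add_le_mul_rpow_add_rpow ‖f v - c‖₊ ‖m - c‖₊ hq
  calc ∑ v, ‖f v - m‖ ^ q
      ≤ ∑ v, 2 ^ (q - 1) * (‖f v - c‖ ^ q + ‖m - c‖ ^ q) := Finset.sum_le_sum fun v _ => h2 v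
    _ = 2 ^ (q - 1) * (∑ v, ‖f v - c‖ ^ q + Fintype.card W * ‖m - c‖ ^ q) := by
        rw [← Finset.mul_sum, Finset.sum_add_distrib, Finset.sum_const, Finset.card_univ,
          nsmul_eq_mul]
    _ ≤ 2 ^ (q - 1) * (∑ v, ‖f v - c‖ ^ q +
          Fintype.card W * ((Fintype.card W : ℝ)⁻¹ * ∑ v, ‖f v - c‖ ^ q)) := by gcongr
    _ = 2 ^ q * ∑ v, ‖f v - c‖ ^ q := by
        rw [mul_inv_cancel_left₀ hN, ← two_mul, ← mul_assoc, ← Real.rpow_add_one two_ne_zero,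
          sub_add_cancel]

end Graph

section Poincare

variable {𝕜 : Type*} [RCLike 𝕜] {W : Type*} [Fintype W] {Λ : SimpleGraph W}
  {E : BanachSp.{u} 𝕜} {q : ℝ}

theorem PoincareInequality.mono {C C' : ℝ} (h : PoincareInequality Λ E q C) (hC : C ≤ C') :
    PoincareInequality Λ E q C' := fun f =>
  (h f).trans (mul_le_mul_of_nonneg_right hC
    (mul_nonneg (by positivity) (Finset.sum_nonneg fun e _ => edgeEnergy_nonneg q f e)))

/-- The Poincaré inequality without the normalization by the number of vertices. -/
theorem poincareInequality_iff [Nonempty W] [Fintype Λ.edgeSet] {C : ℝ} :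
    PoincareInequality Λ E q C ↔ ∀ f : W → E.carrier,
      ∑ v, ‖f v - (Fintype.card W : 𝕜)⁻¹ • ∑ w, f w‖ ^ q ≤
        C * ∑ e ∈ Λ.edgeFinset, edgeEnergy q f e := by
  have hN : 0 < 1 / (Fintype.card W : ℝ) :=
    one_div_pos.2 (by exact_mod_cast Fintype.card_pos)
  refine forall_congr' fun f => ?_
  rw [mul_left_comm, mul_le_mul_iff_right₀ hN]
  have : ∀ (i₁ i₂ : Fintype Λ.edgeSet), (@SimpleGraph.edgeFinset _ Λ i₁) =
    (@SimpleGraph.edgeFinset _ Λ i₂) := fun i₁ i₂ => by rw [Subsingleton.elim i₁ i₂]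
  rw [this _ ‹Fintype Λ.edgeSet›]

theorem exists_poincareInequality_of_connected (hΛ : Λ.Connected) (hq : 1 ≤ q) :
    ∃ C : ℝ, 0 < C ∧ PoincareInequality Λ E q C := by
  classical
  have := hΛ.nonempty
  have hq0 : 0 < q := zero_lt_one.trans_le hq
  let B : ℝ := ∑ v, ∑ w, (Λ.dist v w : ℝ)
  have hB : 0 ≤ B := by positivity
  refine ⟨Fintype.card W * B ^ q + 1, by positivity, poincareInequality_iff.2 fun f => ?_⟩
  set S := ∑ e ∈ Λ.edgeFinset, edgeEnergy q f e with hS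
  have hS0 : 0 ≤ S := Finset.sum_nonneg fun e _ => edgeEnergy_nonneg q f e
  have hadj : ∀ v w, Λ.Adj v w → ‖f v - f w‖ ≤ S ^ q⁻¹ := by
    intro v w h
    rw [Real.le_rpow_inv_iff_of_pos (norm_nonneg _) hS0 hq0, ← edgeEnergy_mk]
    exact Finset.single_le_sum (fun e _ => edgeEnergy_nonneg q f e)
      (SimpleGraph.mem_edgeFinset.2 h)
  have hv : ∀ v, ‖f v - (Fintype.card W : 𝕜)⁻¹ • ∑ w, f w‖ ^ q ≤ B ^ q * S := by
    intro v
    have h1 : ‖f v - (Fintype.card W : 𝕜)⁻¹ • ∑ w, f w‖ ≤ B * S ^ q⁻¹ := by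
      rw [norm_sub_rev]
      refine (norm_mean_sub_le 𝕜 f (f v)).trans ?_
      have hw : ∀ w, ‖f w - f v‖ ≤ B * S ^ q⁻¹ := fun w => by
        refine (norm_sub_le_dist_mul_of_adj hΛ f hadj w v).trans ?_
        gcongr
        exact (Finset.single_le_sum (f := fun v => (Λ.dist w v : ℝ))
          (fun _ _ => Nat.cast_nonneg _) (Finset.mem_univ v)).trans
          (Finset.single_le_sum (f := fun w => ∑ v, (Λ.dist w v : ℝ))
            (fun _ _ => by positivity) (Finset.mem_univ w))
      refine (Finset.sum_le_sum fun w _ =>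
        mul_le_mul_of_nonneg_left (hw w) (by positivity)).trans_eq ?_
      rw [Finset.sum_const, Finset.card_univ, nsmul_eq_mul, mul_inv_cancel_left₀]
      exact_mod_cast Fintype.card_ne_zero
    refine (Real.rpow_le_rpow (norm_nonneg _) h1 hq0.le).trans_eq ?_
    rw [Real.mul_rpow hB (by positivity), Real.rpow_inv_rpow hS0 hq0.ne']
  refine (Finset.sum_le_sum fun v _ => hv v).trans ?_
  rw [Finset.sum_const, Finset.card_univ, nsmul_eq_mul, ← mul_assoc]
  exact mul_le_mul_of_nonneg_right (by linarith) hS0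

/-- A Poincaré constant for all but finitely many of a sequence of connected graphs can be enlarged
to one for all of them. -/
theorem exists_forall_poincareInequality_of_eventually {W : ℕ → Type*} [∀ n, Fintype (W n)]
    {Λ : ∀ n, SimpleGraph (W n)} (hΛ : ∀ n, (Λ n).Connected) (hq : 1 ≤ q) {C : ℝ}
    (h : ∀ᶠ n in atTop, PoincareInequality (Λ n) E q C) :
    ∃ C' : ℝ, 0 < C' ∧ ∀ n, PoincareInequality (Λ n) E q C' := by
  obtain ⟨N, hN⟩ := eventually_atTop.1 h
  choose c hc0 hc using fun n => exists_poincareInequality_of_connected (E := E) (hΛ n) hq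
  have hsum : 0 ≤ ∑ n ∈ Finset.range N, c n := Finset.sum_nonneg fun n _ => (hc0 n).le
  refine ⟨|C| + ∑ n ∈ Finset.range N, c n + 1, by positivity, fun n => ?_⟩
  rcases lt_or_ge n N with hn | hn
  · refine (hc n).mono ?_
    have := Finset.single_le_sum (fun n _ => (hc0 n).le) (Finset.mem_range.2 hn)
    linarith [abs_nonneg C]
  · refine (hN n hn).mono ?_
    linarith [le_abs_self C]

end Poincare

/-! ### From a failing Poincaré inequality to almost minimal displacement -/

section Extend

variable {𝕜 : Type*} [RCLike 𝕜] {A E : Type*} [NormedAddCommGroup E] [NormedSpace 𝕜 E]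
  {p : ℝ≥0∞}

/-- A function on a finite set `A`, as a vector in the `ℓ_p`-space over countably many copies of
`A` that is supported in the zeroth copy. -/
noncomputable def lpExtend [Finite A] (p : ℝ≥0∞) (f : A → E) :
    lp (fun _ : (Σ _ : ℕ, A) => E) p :=
  ⟨fun i => if i.1 = 0 then f i.2 else 0, (memℓp_zero
    ((Set.finite_range fun a : A => (⟨0, a⟩ : Σ _ : ℕ, A)).subset (by
      rintro ⟨n, a⟩ h
      by_cases hn : n = 0
      · subst hn; exact ⟨a, rfl⟩
      · exact absurd (if_neg hn) h))).of_exponent_ge zero_le⟩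

theorem lpExtend_apply [Finite A] (f : A → E) (n : ℕ) (a : A) :
    lpExtend p f ⟨n, a⟩ = if n = 0 then f a else 0 :=
  rfl

variable [hp : Fact (1 ≤ p)]

theorem sum_norm_rpow_le_norm_lp_rpow [Fintype A] (hp_top : p ≠ ∞)
    (x : lp (fun _ : (Σ _ : ℕ, A) => E) p) :
    ∑ a, ‖x ⟨0, a⟩‖ ^ p.toReal ≤ ‖x‖ ^ p.toReal := by
  have := lp.sum_rpow_le_norm_rpow (toReal_pos_of_fact hp_top) x
    (Finset.univ.map ⟨fun a : A => (⟨0, a⟩ : Σ _ : ℕ, A), fun _ _ h => sigma_mk_injective h⟩)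
  rwa [Finset.sum_map] at this

theorem norm_lpExtend_rpow [Fintype A] (hp_top : p ≠ ∞) (f : A → E) :
    ‖lpExtend p f‖ ^ p.toReal = ∑ a, ‖f a‖ ^ p.toReal := by
  have h0 := toReal_pos_of_fact hp_top
  rw [lp.norm_rpow_eq_tsum h0, tsum_eq_sum
    (s := Finset.univ.map ⟨fun a : A => (⟨0, a⟩ : Σ _ : ℕ, A), fun _ _ h => sigma_mk_injective h⟩),
    Finset.sum_map]
  · rfl
  · rintro ⟨n, a⟩ h
    have hn : n ≠ 0 := by
      rintro rfl
      exact h (Finset.mem_map.2 ⟨a, Finset.mem_univ a, rfl⟩)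
    rw [lpExtend_apply, if_neg hn, norm_zero, Real.zero_rpow h0.ne']

theorem lpRep_lpExtend_sub [Group A] [Finite A] (hp_top : p ≠ ∞) (a : A) (f : A → E) :
    lpRep 𝕜 (Σ _ : ℕ, A) E hp_top A a (lpExtend p f) - lpExtend p f =
      lpExtend p fun b => f (a⁻¹ * b) - f b := by
  ext ⟨n, b⟩
  rw [lp.coeFn_sub, Pi.sub_apply, lpRep_apply]
  change lpExtend p f ⟨n, a⁻¹ * b⟩ - _ = _
  simp only [lpExtend_apply]
  split_ifs <;> simp

end Extend

section Key

variable {𝕜 : Type*} [RCLike 𝕜] {r : ℕ} (K : MarkedGroup.{v} r)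
  {p : ℝ≥0∞} [hp : Fact (1 ≤ p)]

theorem norm_lpRep_lpExtend_sub_rpow_le [Fintype K.carrier] {E : Type*} [NormedAddCommGroup E]
    [NormedSpace 𝕜 E] [Fintype K.cayleyGraph.edgeSet] (hp_top : p ≠ ∞)
    (f : K.carrier → E) (j : Fin r) :
    ‖lpRep 𝕜 (Σ _ : ℕ, K.carrier) E hp_top K.carrier (K.gen j) (lpExtend p f) -
        lpExtend p f‖ ^ p.toReal ≤
      2 * ∑ e ∈ K.cayleyGraph.edgeFinset, edgeEnergy p.toReal f e := by
  rw [lpRep_lpExtend_sub, norm_lpExtend_rpow hp_top,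
    ← Equiv.sum_comp (Equiv.mulLeft (K.gen j))]
  simp only [Equiv.coe_mulLeft, inv_mul_cancel_left]
  exact sum_norm_sub_rpow_le_two_mul_sum_edgeEnergy K.cayleyGraph (toReal_pos_of_fact hp_top)
    (fun v => K.gen j * v) (fun v hv => K.cayleyGraph_adj.2 ⟨hv, Or.inl ⟨j, rfl⟩⟩) f

/-- Vectors fixed by the generators are constant on the zeroth copy of the group. -/
theorem apply_eq_apply_one_of_lpRep_gen_eq {E : Type*} [NormedAddCommGroup E] [NormedSpace 𝕜 E]
    (hp_top : p ≠ ∞) {y : lp (fun _ : (Σ _ : ℕ, K.carrier) => E) p}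
    (hy : ∀ j, lpRep 𝕜 (Σ _ : ℕ, K.carrier) E hp_top K.carrier (K.gen j) y = y)
    (g : K.carrier) : y ⟨0, g⟩ = y ⟨0, 1⟩ := by
  have hg : lpRep 𝕜 (Σ _ : ℕ, K.carrier) E hp_top K.carrier g y = y := by
    have hmem : g ∈ Subgroup.closure (Set.range K.gen) := by rw [K.closure_gen]; trivial
    induction hmem using Subgroup.closure_induction with
    | mem x hx => obtain ⟨j, rfl⟩ := hx; exact hy j
    | one => simp
    | mul a b _ _ ha hb => rw [map_mul, LinearIsometryEquiv.coe_mul, Function.comp_apply, hb, ha]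
    | inv a _ ha =>
      rw [map_inv]
      nth_rewrite 1 [← ha]
      simp
  have h := congrArg (fun x : lp (fun _ : (Σ _ : ℕ, K.carrier) => E) p => x ⟨0, g⟩) hg
  rw [← h, lpRep_apply]
  change y ⟨0, g⁻¹ * g⟩ = _
  rw [inv_mul_cancel]

/-- If the Poincaré inequality fails on a Cayley graph, a violating function is a vector in the
permutation representation that lies much farther from the invariant vectors than it is
displaced. In the constant, `2` counts the orientations of an edge and `r` the generators, and
`4 = 2 * 2` combines the loss in replacing the mean by another constant with the factor needed in
`exists_almost_minimal`. -/
theorem exists_displacement_eq_one_of_not_poincareInequality [Fintype K.carrier]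
    {E : BanachSp.{u} 𝕜}
    (hp_top : p ≠ ∞) {R : ℝ} (hR : 0 ≤ R)
    (h : ¬ PoincareInequality K.cayleyGraph E p.toReal (2 * (4 * R * r) ^ p.toReal)) :
    ∃ y : lp (fun _ : (Σ _ : ℕ, K.carrier) => E.carrier) p,
      displacement (lpRep 𝕜 _ E.carrier hp_top K.carrier) K.gen y = 1 ∧
      ∀ z, ‖z - y‖ ≤ R →
        1 / 2 ≤ displacement (lpRep 𝕜 _ E.carrier hp_top K.carrier) K.gen z := by
  classical
  have h0 := toReal_pos_of_fact (p := p) hp_top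
  have h1 : 1 ≤ p.toReal := by
    rw [← ENNReal.toReal_one]
    exact ENNReal.toReal_mono hp_top hp.out
  have : Nonempty K.carrier := ⟨1⟩
  set q := p.toReal
  rw [poincareInequality_iff] at h
  push Not at h
  obtain ⟨f, hf⟩ := h
  set S := ∑ e ∈ K.cayleyGraph.edgeFinset, edgeEnergy q f e with hS
  have hS0 : 0 ≤ S := Finset.sum_nonneg fun e _ => edgeEnergy_nonneg q f e
  refine exists_displacement_eq_one _ _ hR (lpExtend p f) fun y hy => ?_
  have hdisp : displacement (lpRep 𝕜 _ E.carrier hp_top K.carrier) K.gen (lpExtend p f) ≤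
      r * (2 * S) ^ q⁻¹ := by
    refine (Finset.sum_le_sum (g := fun _ => (2 * S) ^ q⁻¹) fun j _ => ?_).trans_eq (by simp)
    rw [Real.le_rpow_inv_iff_of_pos (norm_nonneg _) (by positivity) h0]
    exact norm_lpRep_lpExtend_sub_rpow_le K hp_top f j
  refine (mul_le_mul_of_nonneg_left hdisp (by positivity)).trans_lt ?_
  rw [← Real.rpow_lt_rpow_iff (by positivity) (norm_nonneg _) h0]
  -- A vector `y` fixed by the generators is constant on the zeroth copy of the group.
  have hfar : 2 * (4 * R * r) ^ q * S < 2 ^ q * ‖lpExtend p f - y‖ ^ q := by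
    refine hf.trans_le ((sum_norm_sub_mean_rpow_le 𝕜 h1 f (y ⟨0, 1⟩)).trans ?_)
    refine mul_le_mul_of_nonneg_left ?_ (by positivity)
    refine (Finset.sum_congr rfl fun g _ => ?_).trans_le
      (sum_norm_rpow_le_norm_lp_rpow hp_top (lpExtend p f - y))
    rw [lp.coeFn_sub, Pi.sub_apply, lpExtend_apply, if_pos rfl,
      apply_eq_apply_one_of_lpRep_gen_eq K hp_top hy g]
  refine lt_of_mul_lt_mul_left (hfar.trans_eq' ?_) (by positivity : (0 : ℝ) ≤ 2 ^ q)
  rw [← mul_assoc, Real.mul_rpow (x := 2 * R * r) (by positivity) (by positivity),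
    Real.rpow_inv_rpow (by positivity) h0.ne', ← mul_assoc,
    ← Real.mul_rpow zero_le_two (by positivity)]
  ring_nf

end Key

/-! ### Expanders from the fixed point property -/

/-- If an infinite limit group has the fixed point property, the Cayley graphs of the approximating
groups satisfy Poincaré inequalities with a common constant: functions that violate the
inequalities with constants tending to infinity yield a limit action without fixed point. -/
theorem exists_forall_poincareInequality_cayleyGraph {𝕜 : Type*} [RCLike 𝕜] {r : ℕ}
    {K : ℕ → MarkedGroup.{v} r} {K_lim : MarkedGroup.{v} r} [∀ n, Fintype (K n).carrier]
    (hlim : ∀ w : FreeGroup (Fin r), ∀ᶠ n in atTop,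
      (FreeGroup.lift (K n).gen w = 1 ↔ FreeGroup.lift K_lim.gen w = 1))
    {𝓔 : Set (BanachSp.{u} 𝕜)} {q : ℝ≥0∞} [hq1 : Fact (1 ≤ q)] (hq : q ≠ ∞)
    {𝒮 : Set (Set (BanachSp.{u} 𝕜))} (h𝒮 : 𝓔 = ⋃₀ 𝒮)
    (hultra : ∀ 𝓢 ∈ 𝒮, ClosedUnderSomeUltraproduct 𝓢) (hF : PropertyF 𝓔 K_lim.carrier)
    {E : BanachSp.{u} 𝕜} (hE : ContainsSpace 𝓔 (lp (fun _ : ℕ => E.carrier) q)) :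
    ∃ C : ℝ, 0 < C ∧ ∀ n, PoincareInequality (K n).cayleyGraph E q.toReal C := by
  have h1 : 1 ≤ q.toReal := by
    rw [← ENNReal.toReal_one]
    exact ENNReal.toReal_mono hq hq1.out
  suffices h : ∃ C, ∀ᶠ n in atTop, PoincareInequality (K n).cayleyGraph E q.toReal C by
    obtain ⟨C, hC⟩ := h
    exact exists_forall_poincareInequality_of_eventually
      (fun n => (K n).cayleyGraph_connected) h1 hC
  by_contra! hcon
  obtain ⟨φ, hφ, hfail⟩ := extraction_forall_of_frequently
    (P := fun n m => ¬ PoincareInequality (K m).cayleyGraph E q.toReal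
      (2 * (4 * (n : ℝ) * r) ^ q.toReal)) fun n => hcon _
  obtain ⟨F, hF𝓔, ⟨e⟩⟩ := hE
  obtain ⟨𝓢, h𝓢, hF𝓢⟩ : ∃ 𝓢 ∈ 𝒮, F ∈ 𝓢 := by rwa [h𝒮] at hF𝓔
  obtain ⟨𝓤, h𝓤, F', hF', ⟨e'⟩⟩ := hultra 𝓢 h𝓢 (fun _ => F) fun _ => hF𝓢
  choose y hy hmin using fun n =>
    exists_displacement_eq_one_of_not_poincareInequality (K (φ n)) hq n.cast_nonneg (hfail n)
  have e'' : ∀ n, Nonempty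
      (lp (fun _ : (Σ _ : ℕ, (K (φ n)).carrier) => E.carrier) q ≃ₗᵢ[𝕜] F.carrier) := by
    intro n
    have : Nonempty (K (φ n)).carrier := ⟨1⟩
    obtain ⟨i⟩ := nonempty_equiv_of_countable (α := Σ _ : ℕ, (K (φ n)).carrier) (β := ℕ)
    exact ⟨(lpReindex 𝕜 E.carrier hq i).trans e.symm⟩
  obtain ⟨α, hα⟩ := exists_limit_action_without_fixedPoint
    (fun w => hφ.tendsto_atTop.eventually (hlim w)) 𝓤 h𝓤
    (fun n => conjRep (e'' n).some (lpRep 𝕜 _ E.carrier hq (K (φ n)).carrier))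
    (fun n => (e'' n).some (y n))
    (fun n => by rw [displacement_conjRep, LinearIsometryEquiv.symm_apply_apply, hy])
    (fun n z hz => by
      rw [displacement_conjRep]
      refine hmin n _ ?_
      rwa [← (e'' n).some.norm_map, map_sub, LinearIsometryEquiv.apply_symm_apply])
  obtain ⟨x, hx⟩ := hF.exists_fixedPoint ⟨F', h𝒮 ▸ ⟨𝓢, h𝓢, hF'⟩, ⟨e'⟩⟩ α
  obtain ⟨g, hg⟩ := hα x
  exact hg (hx g)

/-- Some infinite finitely generated subgroup has the fixed point property: the given one when the
class contains a nonzero space, and the whole group otherwise. -/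
theorem exists_ofWords_infinite_propertyF {𝕜 : Type*} [RCLike 𝕜] {k : ℕ} (G : MarkedGroup.{v} k)
    {𝓔 : Set (BanachSp.{u} 𝕜)} {q : ℝ≥0∞} [Fact (1 ≤ q)] (hq : q ≠ ∞)
    (hlq : ∀ E ∈ 𝓔, ContainsSpace 𝓔 (lp (fun _ : ℕ => E.carrier) q))
    (H : Subgroup G.carrier) [Infinite H] (hF : PropertyF 𝓔 H) :
    ∃ (r : ℕ) (w : Fin r → FreeGroup (Fin k)),
      Infinite (G.ofWords w).carrier ∧ PropertyF 𝓔 (G.ofWords w).carrier := by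
  by_cases hE : ∃ E ∈ 𝓔, Nontrivial E.carrier
  · obtain ⟨E, hE𝓔, hE⟩ := hE
    have hfg : H.FG := (Group.fg_iff_subgroup_fg H).1 (fg_of_propertyF hF hq (hlq E hE𝓔))
    obtain ⟨T, hT, hTfin⟩ := (Subgroup.fg_iff H).1 hfg
    obtain ⟨r, t, -, rfl⟩ := hTfin.fin_param
    choose w hw using fun j => G.lift_gen_surjective (t j)
    have hcl : H = Subgroup.closure (Set.range fun j => FreeGroup.lift G.gen (w j)) := by
      rw [← hT]; simp only [hw]
    let e : H ≃* (G.ofWords w).carrier := MulEquiv.subgroupCongr hcl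
    exact ⟨r, w, Infinite.of_injective e e.injective, hF.of_mulEquiv e⟩
  · push Not at hE
    refine ⟨k, FreeGroup.of, ?_, fun E hE𝓔 α => ?_⟩
    · have : Infinite G.carrier := Infinite.of_injective _ (Subtype.val_injective (p := (· ∈ H)))
      refine Infinite.of_surjective (G.ofWordsVal FreeGroup.of) fun g => ?_
      obtain ⟨x, rfl⟩ := G.lift_gen_surjective g
      refine ⟨FreeGroup.lift (G.ofWords FreeGroup.of).gen x, ?_⟩
      rw [MarkedGroup.ofWordsVal_lift, FreeGroup.lift_of_eq_id, MonoidHom.id_apply]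
    · have := hE E hE𝓔
      exact ⟨0, fun h => Subsingleton.elim _ _⟩

theorem mainTheorem9 {𝕜 : Type*} [RCLike 𝕜] {k : ℕ}
    (G : ℕ → MarkedGroup.{v} k) (G_lim : MarkedGroup.{v} k)
    (hfin : ∀ m, Finite (G m).carrier)
    (hlim : Tendsto G atTop (𝓝 G_lim))
    (𝓔 : Set (BanachSp.{u} 𝕜)) (hne : 𝓔.Nonempty)
    (q : ℝ≥0∞) [Fact (1 ≤ q)] (hq : q ≠ ∞)
    (hlq : ∀ E ∈ 𝓔, ContainsSpace 𝓔 (lp (fun _ : ℕ => E.carrier) q))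
    (hultra : ∃ 𝒮 : Set (Set (BanachSp.{u} 𝕜)),
      𝓔 = ⋃₀ 𝒮 ∧ ∀ 𝓢 ∈ 𝒮, ClosedUnderSomeUltraproduct 𝓢)
    (H : Subgroup G_lim.carrier) (hinf : Infinite H) (hF : PropertyF 𝓔 H) :
    AdmitsEmbeddedBanachExpanders 𝓔 q.toReal (fun m => (G m).cayleyGraph) := by
  obtain ⟨𝒮, h𝒮, hultra⟩ := hultra
  obtain ⟨r, w, hinf', hF'⟩ := exists_ofWords_infinite_propertyF G_lim hq hlq H hF
  have hfin' : ∀ m, Finite ((G m).ofWords w).carrier := fun m =>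
    Finite.of_injective _ ((G m).ofWordsVal_injective w)
  let inst : ∀ m, Fintype ((G m).ofWords w).carrier := fun m => Fintype.ofFinite _
  have hlim' : ∀ x : FreeGroup (Fin r), ∀ᶠ m in atTop,
      (FreeGroup.lift ((G m).ofWords w).gen x = 1 ↔
        FreeGroup.lift (G_lim.ofWords w).gen x = 1) := fun x => by
    simp only [MarkedGroup.lift_ofWords_eq_one_iff]
    exact MarkedGroup.eventually_lift_eq_one_iff hlim _
  obtain ⟨B, hB⟩ := MarkedGroup.exists_dist_ofWordsVal_le.{v} w
  refine ⟨MarkedGroup.isBoundedDegreeFamily_cayleyGraph G hfin, id, strictMono_id,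
    fun m => ((G m).ofWords w).carrier, inst, fun m => ((G m).ofWords w).cayleyGraph,
    MarkedGroup.isBoundedDegreeFamily_cayleyGraph _ hfin',
    ⟨B + 1, by positivity, fun m => ⟨(G m).ofWordsVal w, (G m).ofWordsVal_injective w,
      fun x y => ?_⟩⟩,
    MarkedGroup.tendsto_card_atTop hlim',
    fun E hE => exists_forall_poincareInequality_cayleyGraph hlim' hq h𝒮 hultra hF' (hlq E hE)⟩
  have h : ((G m).cayleyGraph.dist ((G m).ofWordsVal w x) ((G m).ofWordsVal w y) : ℝ) ≤
      B * (((G m).ofWords w).cayleyGraph.dist x y : ℝ) := by exact_mod_cast hB (G m) x y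
  exact h.trans (mul_le_mul_of_nonneg_right (by linarith) (Nat.cast_nonneg _))
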